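/- Let $\mathcal H$ be a real Hilbert space, let $A:\mathcal H\to 2^{\mathcal H}$ be maximally monotone, $\operatorname{zer}A=\{x\in\mathcal H: 0\in A(x)\}$, and for $c>0$ let $J_{cA}=(\mathrm{Id}+cA)^{-1}$ be the resolvent of $cA$ (which is single-valued and defined on all of $\mathcal H$). Let $u,x_0\in\mathcal H$, and for $k\in\mathbb N=\{0,1,2,\dots\}$ let $e_k\in\mathcal H$, $c_k>0$, $\alpha_k,\beta_k,\gamma_k,\delta_k\in\mathbb R$, and $$x_{k+1}=\alpha_k u+\beta_k x_k+\gamma_k J_{c_kA}(x_k)+\delta_k e_k .$$ Put $\xi_k=\left|\beta_k+\frac{\gamma_k}{2}\right|+\left|\frac{\gamma_k}{2}\right|$. Assume that one of the following holds. (I) $\limsup_{k\to\infty}\xi_k<1$, $\sup_k|\alpha_k|<\infty$ and $\sup_k\|\delta_ke_k\|<\infty$. (II) $\xi_k\le 1$ for all $k$, and each of the following three holds: [$|\alpha_k|+\xi_k\le 1$ for all $k$, or $\sum_k|\alpha_k|<\infty$]; [($\xi_k+|\delta_k|\le 1$ for all $k$ and $\sup_k\|e_k\|<\infty$), or $\sum_k\|\delta_ke_k\|<\infty$];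 [$\xi_k+|1-\beta_k-\gamma_k|\le 1$ for all $k$, or $\sum_k|1-\beta_k-\gamma_k|<\infty$]. (III) $|\alpha_k|+\xi_k\le 1$ for all $k$, $\sum_k|1-\alpha_k-\beta_k-\gamma_k|<\infty$ and $\sum_k\|\delta_ke_k\|<\infty$. (IV) $\sup_k\|e_k\|<\infty$, $\sum_k|\alpha_k|<\infty$, $\sum_k|1-\beta_k-\gamma_k-\delta_k|<\infty$, and $\xi_k+|\delta_k|\le 1$ for all $k$. (V) $\alpha_k\in\,]0,1]$ and $\alpha_k+\xi_k\le 1$ for all $k$, $\frac{\delta_ke_k}{\alpha_k}\to 0$ and $\frac{1-\alpha_k-\beta_k-\gamma_k}{\alpha_k}\to 0$. Then: (i) If $\operatorname{zer}A\neq\varnothing$, then $(x_k)_{k\in\mathbb N}$ is bounded. (ii) Suppose in addition that one of the following holds. (a) $c_k\to\infty$, $\alpha_k\to 0$, $\beta_k\to 0$, $\gamma_k\to 1$ and $\delta_ke_k\to 0$. (b) $\beta_k+\gamma_k\le 1$ for all $k$, $\alpha_k\to 0$, $\limsup_{k\to\infty}|\beta_k|<1$, $1-\alpha_k-\beta_k-\gamma_k\to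 0$, $0<\liminf_{k\to\infty}\left(1-\beta_k-\frac{\gamma_k}{2}\right)\le\limsup_{k\to\infty}\left(1-\beta_k-\frac{\gamma_k}{2}\right)<1$, $\delta_ke_k\to 0$, $1-\frac{c_k}{c_{k+1}}\to 0$, and [$\inf_kc_k>0$ or $c_k\to\infty$]. (c) [$\sum_k|\alpha_{k+1}-\alpha_k|<\infty$, or ($|\gamma_k|\ne 1$ for all $k$ and $\lim_{k\to\infty}\frac{|\alpha_{k+1}-\alpha_k|}{1-|\gamma_{k+1}|}=0$)], $|\gamma_k|\in[0,1]$ for all $k$, $\alpha_k\to 0$, $\alpha_k+\gamma_k\to 1$, $\sum_k|(\alpha_{k+1}+\gamma_{k+1})-(\alpha_k+\gamma_k)|<\infty$, $\sum_k|\beta_k|<\infty$, $\sum_k(1-|\gamma_k|)=\infty$, $\sum_k\|\delta_ke_k\|<\infty$, $\inf_kc_k>0$ and $\sum_k|c_{k+1}-c_k|<\infty$. Then $\operatorname{zer}A\neq\varnothing$ if and only if $(x_k)_{k\in\mathbb N}$ is bounded. -/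

import Mathlib

open Filter Topology
open scoped Pointwise

namespace GenPPA

section Operators

variable {H : Type*} [NormedAddCommGroup H] [InnerProductSpace ℝ H]

/-- A set-valued operator `A : H → Set H` is monotone. -/
def IsMonotone (A : H → Set H) : Prop :=
  ∀ x u y v, u ∈ A x → v ∈ A y → 0 ≤ inner ℝ (x - y) (u - v)

/-- A set-valued operator is maximally monotone: it is monotone and its graph is not properly
contained in the graph of a monotone operator. -/
def IsMaximallyMonotone (A : H → Set H) : Prop :=
  IsMonotone A ∧ ∀ B : H → Set H, IsMonotone B → (∀ x, A x ⊆ B x) → B = A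

/-- The pointwise form of maximal monotonicity. -/
theorem isMaximallyMonotone_iff (A : H → Set H) :
    IsMaximallyMonotone A ↔
      ∀ x u, u ∈ A x ↔ ∀ y v, v ∈ A y → 0 ≤ inner ℝ (x - y) (u - v) := by
  constructor
  · rintro ⟨hm, hmax⟩ x u
    refine ⟨fun hu y v hv => hm x u y v hu hv, fun h => ?_⟩
    have hB : IsMonotone (fun z => {w | w ∈ A z ∨ (z = x ∧ w = u)}) := by
      rintro a b a' b' (hb | ⟨rfl, rfl⟩) (hb' | ⟨rfl, rfl⟩)
      · exact hm _ _ _ _ hb hb'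
      · rw [← neg_sub a' a, ← neg_sub b' b, inner_neg_neg]
        exact h _ _ hb
      · exact h _ _ hb'
      · simp
    have hEq := hmax _ hB (fun z w hw => Or.inl hw)
    rw [← hEq]
    exact Or.inr ⟨rfl, rfl⟩
  · intro h
    have hm : IsMonotone A := fun x u y v hu hv => (h x u).1 hu y v hv
    refine ⟨hm, fun B hB hAB => ?_⟩
    funext x
    exact Set.Subset.antisymm
      (fun u hu => (h x u).2 fun y v hv => hB x u y v hu (hAB y hv)) (hAB x)

/-- The set of zeros of a set-valued operator. -/
def zer (A : H → Set H) : Set H := {x | 0 ∈ A x}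

/-- The resolvent `(Id + G)⁻¹` of a set-valued operator: `y` belongs to its value at `x` iff
`x ∈ y + G y`. -/
def resolvent (G : H → Set H) (x : H) : Set H := {y | ∃ w ∈ G y, x = y + w}

/-- The resolvent of a monotone operator is at most single-valued. -/
theorem resolvent_subsingleton {G : H → Set H} (hG : IsMonotone G) (x : H) :
    (resolvent G x).Subsingleton := by
  rintro y ⟨w, hw, h1⟩ y' ⟨w', hw', h2⟩
  have h := hG y w y' w' hw hw'
  have e : w - w' = -(y - y') := by
    have h3 : y + w = y' + w' := h1.symm.trans h2
    have h4 : w = y' + w' - y := by rw [← h3]; abel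
    rw [h4]; abel
  rw [e, inner_neg_right, real_inner_self_eq_norm_sq] at h
  have h0 : ‖y - y'‖ = 0 := by nlinarith [norm_nonneg (y - y')]
  exact sub_eq_zero.1 (norm_eq_zero.1 h0)

/-- `x` is a sequence of iterates of the generalized proximal point algorithm,
`x (k+1) = α k • u + β k • x k + γ k • J_{c k • A} (x k) + δ k • e k` for all `k`.
For a maximally monotone `A` and `c k > 0` the resolvent has exactly one value at every point,
here called `y`; the operator `c k • A` is `z ↦ c k • A z`. -/
def IsIteration (A : H → Set H) (u : H) (e : ℕ → H) (c α β γ δ : ℕ → ℝ) (x : ℕ → H) : Prop :=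
  ∀ k, ∃ y ∈ resolvent (c k • A) (x k),
    x (k + 1) = α k • u + β k • x k + γ k • y + δ k • e k

end Operators

section Conditions

/-! Upper and lower limits of real sequences are taken in the extended reals, so that they are
meaningful for unbounded sequences too. -/

/-- `|b + g/2| + |g/2|`. -/
noncomputable def xi (b g : ℝ) : ℝ := |b + g / 2| + |g / 2|

/-- The divergence `∑ a k = ∞`. -/
def SumDiverges (a : ℕ → ℝ) : Prop :=
  Tendsto (fun n => ∑ k ∈ Finset.range n, a k) atTop atTop

variable {H : Type*} [NormedAddCommGroup H] [InnerProductSpace ℝ H]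

def CondI (e : ℕ → H) (α β γ δ : ℕ → ℝ) : Prop :=
  limsup (fun k => ((xi (β k) (γ k) : ℝ) : EReal)) atTop < 1 ∧
  BddAbove (Set.range fun k => |α k|) ∧
  BddAbove (Set.range fun k => ‖δ k • e k‖)

def CondII (e : ℕ → H) (α β γ δ : ℕ → ℝ) : Prop :=
  (∀ k, xi (β k) (γ k) ≤ 1) ∧
  ((∀ k, |α k| + xi (β k) (γ k) ≤ 1) ∨ Summable fun k => |α k|) ∧
  (((∀ k, xi (β k) (γ k) + |δ k| ≤ 1) ∧ BddAbove (Set.range fun k => ‖e k‖)) ∨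
    Summable fun k => ‖δ k • e k‖) ∧
  ((∀ k, xi (β k) (γ k) + |1 - β k - γ k| ≤ 1) ∨ Summable fun k => |1 - β k - γ k|)

def CondIII (e : ℕ → H) (α β γ δ : ℕ → ℝ) : Prop :=
  (∀ k, |α k| + xi (β k) (γ k) ≤ 1) ∧
  (Summable fun k => |1 - α k - β k - γ k|) ∧
  (Summable fun k => ‖δ k • e k‖)

def CondIV (e : ℕ → H) (α β γ δ : ℕ → ℝ) : Prop :=
  BddAbove (Set.range fun k => ‖e k‖) ∧
  (Summable fun k => |α k|) ∧
  (Summable fun k => |1 - β k - γ k - δ k|) ∧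
  (∀ k, xi (β k) (γ k) + |δ k| ≤ 1)

def CondV (e : ℕ → H) (α β γ δ : ℕ → ℝ) : Prop :=
  (∀ k, 0 < α k ∧ α k ≤ 1 ∧ α k + xi (β k) (γ k) ≤ 1) ∧
  Tendsto (fun k => (α k)⁻¹ • (δ k • e k)) atTop (𝓝 0) ∧
  Tendsto (fun k => (1 - α k - β k - γ k) / α k) atTop (𝓝 0)

def CondA (e : ℕ → H) (c α β γ δ : ℕ → ℝ) : Prop :=
  Tendsto c atTop atTop ∧
  Tendsto α atTop (𝓝 0) ∧
  Tendsto β atTop (𝓝 0) ∧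
  Tendsto γ atTop (𝓝 1) ∧
  Tendsto (fun k => δ k • e k) atTop (𝓝 0)

def CondB (e : ℕ → H) (c α β γ δ : ℕ → ℝ) : Prop :=
  (∀ k, β k + γ k ≤ 1) ∧
  Tendsto α atTop (𝓝 0) ∧
  limsup (fun k => ((|β k| : ℝ) : EReal)) atTop < 1 ∧
  Tendsto (fun k => 1 - α k - β k - γ k) atTop (𝓝 0) ∧
  0 < liminf (fun k => ((1 - β k - γ k / 2 : ℝ) : EReal)) atTop ∧
  limsup (fun k => ((1 - β k - γ k / 2 : ℝ) : EReal)) atTop < 1 ∧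
  Tendsto (fun k => δ k • e k) atTop (𝓝 0) ∧
  Tendsto (fun k => 1 - c k / c (k + 1)) atTop (𝓝 0) ∧
  ((0 < ⨅ k, c k) ∨ Tendsto c atTop atTop)

def CondC (e : ℕ → H) (c α β γ δ : ℕ → ℝ) : Prop :=
  ((Summable fun k => |α (k + 1) - α k|) ∨
    ((∀ k, |γ k| ≠ 1) ∧
      Tendsto (fun k => |α (k + 1) - α k| / (1 - |γ (k + 1)|)) atTop (𝓝 0))) ∧
  (∀ k, |γ k| ≤ 1) ∧
  Tendsto α atTop (𝓝 0) ∧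
  Tendsto (fun k => α k + γ k) atTop (𝓝 1) ∧
  (Summable fun k => |(α (k + 1) + γ (k + 1)) - (α k + γ k)|) ∧
  (Summable fun k => |β k|) ∧
  SumDiverges (fun k => 1 - |γ k|) ∧
  (Summable fun k => ‖δ k • e k‖) ∧
  (0 < ⨅ k, c k) ∧
  (Summable fun k => |c (k + 1) - c k|)

end Conditions

end GenPPA

/-!
Write `y k` for the resolvent value at `x k` and `w k = (c k)⁻¹ • (x k - y k) ∈ A (y k)`.

*Zeros give boundedness.* The reflected resolvent `x k ↦ 2 y k - x k = y k - c k • w k` is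
nonexpansive (`IsMonotone.norm_reflection_sub_le`) and fixes every zero `z`. As
`β x + γ y = (β + γ / 2) x + (γ / 2) (2 y - x)`, this gives
`‖x (k + 1) - z‖ ≤ xi (β k) (γ k) * ‖x k - z‖ + ‖α k • u + δ k • e k - (1 - β k - γ k) • z‖`. Under
each of the five conditions the last term is at most a constant multiple of the deficit of a
contraction factor plus a summable error (`IsAbsorbed`), and such a recursion is bounded
(`bddAbove_range_of_eventually_le_convex_add_summable`).

*Boundedness gives zeros.* If `y` is bounded and `w → 0`, then a weak cluster point of `y` is a zero
by maximality (`IsMaximallyMonotone.zer_nonempty_of_tendsto`). Bounded iterates have bounded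
resolvent values, so it remains to see that `w → 0`. This is immediate if `c k → ∞`. Otherwise `c`
is bounded away from zero, and it suffices that `x k - y k → 0`. Under condition (b), `x (k + 1)` is
asymptotically an average of `x k` and its reflection, and `x k - y k → 0` is a lemma of Suzuki's
type (`tendsto_zero_of_averaged_steps`), which has a short proof from the parallelogram identity.
Under condition (c), `x (k + 1) - y k → 0`, and `x (k + 1) - x k → 0` by the lemma of Xu
(`tendsto_zero_of_le_convex_add_summable`). In both cases resolvents with different parameters are
compared at the point `y k + c (k + 1) • w k`, where the resolvent with parameter `c (k + 1)` has
the value `y k` by construction; the surjectivity theorem of Minty is not needed.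
-/

namespace GenPPA

/-! ### Recursive inequalities for real sequences -/

section RealSequences

/-- A recursion towards convex combinations with a constant `K`, up to summable errors, keeps a
sequence below the larger of `K` and its starting value, plus the sum of the errors. -/
theorem bddAbove_range_of_eventually_le_convex_add_summable {a ξ s : ℕ → ℝ} {K : ℝ}
    (hs0 : ∀ k, 0 ≤ s k) (hs : Summable s)
    (h : ∀ᶠ k in atTop, 0 ≤ ξ k ∧ ξ k ≤ 1 ∧ a (k + 1) ≤ ξ k * a k + ((1 - ξ k) * K + s k)) :
    BddAbove (Set.range a) := by
  obtain ⟨N, hN⟩ := eventually_atTop.1 h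
  have key : ∀ n, a (N + n) ≤ max (a N) K + ∑ j ∈ Finset.range (N + n), s j := by
    intro n
    induction n with
    | zero => exact le_add_of_le_of_nonneg (le_max_left _ _) (Finset.sum_nonneg fun j _ => hs0 j)
    | succ n ih =>
      obtain ⟨h0, h1, h2⟩ := hN (N + n) (Nat.le_add_right _ _)
      rw [← add_assoc, Finset.sum_range_succ]
      have hS : 0 ≤ ∑ j ∈ Finset.range (N + n), s j := Finset.sum_nonneg fun j _ => hs0 j
      have h3 := mul_le_mul_of_nonneg_left ih h0
      have h4 := mul_le_mul_of_nonneg_left (le_max_right (a N) K) (sub_nonneg.2 h1)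
      have h5 := mul_le_mul_of_nonneg_right h1 hS
      linarith
  have hb : IsBoundedUnder (· ≤ ·) atTop a := by
    refine ⟨max (a N) K + ∑' j, s j, ?_⟩
    rw [eventually_map]
    filter_upwards [eventually_ge_atTop N] with k hk
    obtain ⟨n, rfl⟩ := Nat.exists_eq_add_of_le hk
    exact (key n).trans (by gcongr; exact hs.sum_le_tsum _ fun j _ => hs0 j)
  exact hb.bddAbove_range

/-- The lemma of Xu: the contraction factors `1 - t k` have vanishing product because their
deficits `t k` are not summable, so the initial value is forgotten. -/
theorem tendsto_zero_of_le_convex_add_summable {a t τ s : ℕ → ℝ} (ha : ∀ k, 0 ≤ a k)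
    (ht0 : ∀ k, 0 ≤ t k) (ht1 : ∀ k, t k ≤ 1) (hdiv : SumDiverges t)
    (hτ : Tendsto τ atTop (𝓝 0)) (hs0 : ∀ k, 0 ≤ s k) (hs : Summable s)
    (h : ∀ k, a (k + 1) ≤ (1 - t k) * a k + t k * τ k + s k) :
    Tendsto a atTop (𝓝 0) := by
  rw [Metric.tendsto_atTop]
  intro ε hε
  obtain ⟨N, hN⟩ := eventually_atTop.1
    ((hτ.eventually (gt_mem_nhds (by positivity : 0 < ε / 3))).and
    ((tendsto_sum_nat_add s).eventually (gt_mem_nhds (by positivity : 0 < ε / 3))))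
  have key : ∀ n, a (n + N) ≤ Real.exp (-∑ j ∈ Finset.range n, t (j + N)) * a N + ε / 3
      + ∑ j ∈ Finset.range n, s (j + N) := by
    intro n
    induction n with
    | zero => simp; positivity
    | succ n ih =>
      have h1 : 1 - t (n + N) ≤ Real.exp (-t (n + N)) := by
        linarith [Real.add_one_le_exp (-t (n + N))]
      have h2 := mul_le_mul_of_nonneg_left ih (sub_nonneg.2 (ht1 (n + N)))
      have h3 : t (n + N) * τ (n + N) ≤ t (n + N) * (ε / 3) :=
        mul_le_mul_of_nonneg_left (hN (n + N) (Nat.le_add_left _ _)).1.le (ht0 _)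
      have hS : 0 ≤ ∑ j ∈ Finset.range n, s (j + N) := Finset.sum_nonneg fun j _ => hs0 _
      have h4 := mul_le_mul_of_nonneg_right h1
        (mul_nonneg (Real.exp_pos (-∑ j ∈ Finset.range n, t (j + N))).le (ha N))
      have h5 := h (n + N)
      have h6 := mul_nonneg (ht0 (n + N)) hS
      rw [Finset.sum_range_succ, Finset.sum_range_succ, neg_add, Real.exp_add,
        show n + 1 + N = n + N + 1 by ring]
      linarith
  have hT : Tendsto (fun n => ∑ j ∈ Finset.range n, t (j + N)) atTop atTop := by
    have h1 : Tendsto (fun n => ∑ j ∈ Finset.range (n + N), t j) atTop atTop :=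
      hdiv.comp (tendsto_add_atTop_nat N)
    refine (tendsto_atTop_add_const_right _ (-∑ j ∈ Finset.range N, t j) h1).congr fun n => ?_
    rw [add_comm n N, Finset.sum_range_add]
    simp [add_comm]
  have hE : Tendsto (fun n => Real.exp (-∑ j ∈ Finset.range n, t (j + N)) * a N) atTop (𝓝 0) := by
    simpa using (Real.tendsto_exp_neg_atTop_nhds_zero.comp hT).mul_const (a N)
  obtain ⟨n₀, hn₀⟩ := eventually_atTop.1 (hE.eventually (gt_mem_nhds (by positivity : 0 < ε / 3)))
  refine ⟨n₀ + N, fun n hn => ?_⟩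
  obtain ⟨m, rfl⟩ := Nat.exists_eq_add_of_le' (le_of_add_le_right hn)
  rw [Real.dist_0_eq_abs, abs_of_nonneg (ha _)]
  have h1 : ∑ j ∈ Finset.range m, s (j + N) ≤ ∑' j, s (j + N) :=
    ((summable_nat_add_iff N).2 hs).sum_le_tsum _ fun j _ => hs0 _
  have h2 := hn₀ m (by omega)
  have h3 := (hN N le_rfl).2
  linarith [key m]

/-- A bounded real sequence attains its upper limit along some filter. -/
theorem exists_filter_tendsto_limsup {a : ℕ → ℝ} (ha : Bornology.IsBounded (Set.range a)) :
    ∃ (D : ℝ) (F : Filter ℕ), F.NeBot ∧ F ≤ atTop ∧ Tendsto a F (𝓝 D) ∧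
      ∀ η > 0, ∀ᶠ k in atTop, a k < D + η := by
  have hle : IsBoundedUnder (· ≤ ·) atTop a := ha.bddAbove.isBoundedUnder_of_range
  have hge : IsBoundedUnder (· ≥ ·) atTop a := ha.bddBelow.isBoundedUnder_of_range
  have hup : ∀ η > 0, ∀ᶠ k in atTop, a k < limsup a atTop + η := fun η hη =>
    eventually_lt_of_limsup_lt (by linarith) hle
  refine ⟨limsup a atTop, atTop ⊓ comap a (𝓝 (limsup a atTop)), ?_, inf_le_left,
    tendsto_comap.mono_left inf_le_right, hup⟩
  have hcl : MapClusterPt (limsup a atTop) atTop a := by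
    refine (Metric.nhds_basis_ball.mapClusterPt_iff_frequently).2 fun η hη => ?_
    refine ((frequently_lt_of_lt_limsup hge.isCoboundedUnder_le
      (show limsup a atTop - η < _ by linarith)).and_eventually (hup η hη)).mono fun k hk => ?_
    rw [Metric.mem_ball, Real.dist_eq, abs_lt]
    constructor <;> linarith [hk.1, hk.2]
  rw [← map_neBot_iff a, Filter.push_pull, inf_comm]
  exact hcl

end RealSequences

/-! ### Monotone operators -/

section Operators

variable {H : Type*} [NormedAddCommGroup H] [InnerProductSpace ℝ H]

/-- The reflected resolvent `y + c • w ↦ y - c • w`, for `w ∈ A y`, is nonexpansive. -/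
theorem IsMonotone.norm_reflection_sub_le {A : H → Set H} (hA : IsMonotone A) {c : ℝ} (hc : 0 ≤ c)
    {y w y' w' : H} (hw : w ∈ A y) (hw' : w' ∈ A y') :
    ‖(y - c • w) - (y' - c • w')‖ ≤ ‖(y + c • w) - (y' + c • w')‖ := by
  have h := mul_nonneg hc (hA y w y' w' hw hw')
  have e1 : (y - c • w) - (y' - c • w') = (y - y') - c • (w - w') := by module
  have e2 : (y + c • w) - (y' + c • w') = (y - y') + c • (w - w') := by module
  rw [e1, e2]
  refine (sq_le_sq₀ (norm_nonneg _) (norm_nonneg _)).1 ?_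
  rw [norm_sub_sq_real, norm_add_sq_real, real_inner_smul_right]
  linarith

/-- Reflected resolvents with different parameters: the point `y + c' • w` has the same resolvent
value `y` for the parameter `c'` as `y + c • w` has for `c`. -/
theorem IsMonotone.norm_reflection_sub_le_add {A : H → Set H} (hA : IsMonotone A) {c c' : ℝ}
    (hc' : 0 ≤ c') {y w y' w' : H} (hw : w ∈ A y) (hw' : w' ∈ A y') :
    ‖(y' - c' • w') - (y - c • w)‖ ≤
      ‖(y' + c' • w') - (y + c • w)‖ + 2 * ‖(c' - c) • w‖ := by
  have h := hA.norm_reflection_sub_le hc' hw' hw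
  have e1 : (y' - c' • w') - (y - c • w) = ((y' - c' • w') - (y - c' • w)) - (c' - c) • w := by
    module
  have e2 : (y' + c' • w') - (y + c' • w) = ((y' + c' • w') - (y + c • w)) - (c' - c) • w := by
    module
  rw [e1]
  rw [e2] at h
  linarith [norm_sub_le ((y' - c' • w') - (y - c' • w)) ((c' - c) • w),
    norm_sub_le ((y' + c' • w') - (y + c • w)) ((c' - c) • w)]

/-- Resolvents with different parameters, compared through the same point `y + c' • w`. -/
theorem IsMonotone.norm_resolvent_sub_le_add {A : H → Set H} (hA : IsMonotone A) {c c' : ℝ}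
    (hc' : 0 ≤ c') {y w y' w' : H} (hw : w ∈ A y) (hw' : w' ∈ A y') :
    ‖y' - y‖ ≤ ‖(y' + c' • w') - (y + c • w)‖ + ‖(c' - c) • w‖ := by
  have h := hA.norm_reflection_sub_le hc' hw' hw
  -- `y' - y` is half the sum of the differences of reflections and of arguments.
  have e1 : (2 : ℝ) • (y' - y) =
      ((y' - c' • w') - (y - c' • w)) + ((y' + c' • w') - (y + c' • w)) := by module
  have e2 : (y' + c' • w') - (y + c' • w) = ((y' + c' • w') - (y + c • w)) - (c' - c) • w := by
    module
  have h1 := norm_add_le ((y' - c' • w') - (y - c' • w)) ((y' + c' • w') - (y + c' • w))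
  rw [← e1, norm_smul, Real.norm_two] at h1
  rw [e2] at h h1
  linarith [norm_sub_le ((y' + c' • w') - (y + c • w)) ((c' - c) • w)]

/-- Bounded points of the graph with values tending to zero produce a zero: the graph is closed in
the weak-strong topology, and bounded sequences have weak cluster points. -/
theorem IsMaximallyMonotone.zer_nonempty_of_tendsto [CompleteSpace H] {A : H → Set H}
    (hA : IsMaximallyMonotone A) {y w : ℕ → H} (hw : ∀ k, w k ∈ A (y k))
    (hy : Bornology.IsBounded (Set.range y)) (hw0 : Tendsto w atTop (𝓝 0)) :
    (zer A).Nonempty := by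
  obtain ⟨M, hM⟩ := hy.exists_norm_le
  have hM' : ∀ k, ‖y k‖ ≤ M := fun k => hM _ ⟨k, rfl⟩
  let f : ℕ → WeakDual ℝ H := fun k => StrongDual.toWeakDual (InnerProductSpace.toDual ℝ H (y k))
  let U : Ultrafilter ℕ := Ultrafilter.of atTop
  have hU : (U : Filter ℕ) ≤ atTop := Ultrafilter.of_le _
  have hcpt := WeakDual.isCompact_closedBall (𝕜 := ℝ) (E := H) 0 M
  obtain ⟨φ, -, hφ⟩ := hcpt.ultrafilter_le_nhds (U.map f) (by
    rw [le_principal_iff]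
    refine Ultrafilter.mem_coe.2 (Ultrafilter.mem_map.2 (Filter.univ_mem' fun k => ?_))
    simpa [f] using hM' k)
  set p : H := (InnerProductSpace.toDual ℝ H).symm (WeakDual.toStrongDual φ) with hp
  have hlim : ∀ v, Tendsto (fun k => inner ℝ (y k) v) U (𝓝 (inner ℝ p v)) := by
    intro v
    have h1 : Tendsto f U (𝓝 φ) := hφ
    have h2 := ((WeakDual.eval_continuous v).tendsto φ).comp h1
    have h3 : inner ℝ p v = φ v := by
      rw [hp, InnerProductSpace.toDual_symm_apply]; rfl
    rw [h3]
    exact h2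
  refine ⟨p, ((isMaximallyMonotone_iff A).1 hA p 0).2 fun q v hv => ?_⟩
  have h1 : Tendsto (fun k => inner ℝ (y k - q) (w k)) U (𝓝 0) := by
    refine squeeze_zero_norm (a := fun k => (M + ‖q‖) * ‖w k‖) (fun k => ?_) ?_
    · refine (norm_inner_le_norm _ _).trans ?_
      gcongr
      exact (norm_sub_le _ _).trans (by gcongr; exact hM' k)
    · simpa using (hw0.norm.const_mul (M + ‖q‖)).mono_left hU
  have h2 : Tendsto (fun k => inner ℝ (y k - q) (w k - v)) U (𝓝 (inner ℝ (p - q) (0 - v))) := by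
    have h3 := h1.sub ((hlim v).sub_const (inner ℝ q v))
    rw [zero_sub, ← inner_sub_left, ← inner_neg_right] at h3
    rw [zero_sub]
    exact h3.congr fun k => by rw [← inner_sub_left, ← inner_sub_right]
  exact ge_of_tendsto' h2 fun k => hA.1 _ _ _ _ (hw k) hv

end Operators

/-! ### Averaged steps -/

section Averaged

variable {H : Type*} [NormedAddCommGroup H] [InnerProductSpace ℝ H]

/-- If `d'` lies about as far out as `d` and is nearly an average of `d` with a vector of the same
length, then `d'` is near `d`: uniform convexity in the form of the parallelogram identity. -/
theorem mul_norm_sub_sq_le_of_norm_sub_smul_le {d d' : H} {lam ε : ℝ}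
    (h : ‖d' - lam • d‖ ≤ (1 - lam) * ‖d‖ + ε) :
    lam * ‖d' - d‖ ^ 2 ≤
      (1 - lam) * (‖d‖ ^ 2 - ‖d'‖ ^ 2) + (2 * (1 - lam) * ‖d‖ * ε + ε ^ 2) := by
  have h1 := pow_le_pow_left₀ (norm_nonneg _) h 2
  rw [norm_sub_sq_real, norm_smul, real_inner_smul_right, mul_pow, Real.norm_eq_abs, sq_abs] at h1
  rw [norm_sub_sq_real]
  linarith

/-- A Hilbert space form of Suzuki's lemma. Suppose that `D = limsup ‖d k‖` is positive. Where
`‖d k‖` is near `D`, uniform convexity forces `d (k - 1)`, and then any fixed number of earlier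
terms, to be near `d k`. The steps of `x` up to time `k` are then multiples of nearly the same
vector, by factors at least `1 - b`, which makes `x` unbounded. -/
theorem tendsto_zero_of_averaged_steps {x d : ℕ → H} {lam ε : ℕ → ℝ} {a b : ℝ} (ha : 0 < a)
    (hb : b < 1) (hlam : ∀ᶠ k in atTop, a ≤ lam k ∧ lam k ≤ b)
    (hx : Bornology.IsBounded (Set.range x)) (hd : Bornology.IsBounded (Set.range d))
    (hstep : Tendsto (fun k => x (k + 1) - x k - (1 - lam k) • d k) atTop (𝓝 0))
    (hε : Tendsto ε atTop (𝓝 0))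
    (h : ∀ᶠ k in atTop, ‖d (k + 1) - lam k • d k‖ ≤ (1 - lam k) * ‖d k‖ + ε k) :
    Tendsto d atTop (𝓝 0) := by
  obtain ⟨X, hX⟩ := hx.exists_norm_le
  obtain ⟨M, hM⟩ := hd.exists_norm_le
  replace hX : ∀ k, ‖x k‖ ≤ X := fun k => hX _ ⟨k, rfl⟩
  replace hM : ∀ k, ‖d k‖ ≤ M := fun k => hM _ ⟨k, rfl⟩
  have hM0 : 0 ≤ M := (norm_nonneg _).trans (hM 0)
  have hbdd : Bornology.IsBounded (Set.range fun k => ‖d k‖) :=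
    isBounded_iff_forall_norm_le.2 ⟨M, by rintro _ ⟨k, rfl⟩; simpa using hM k⟩
  obtain ⟨D, F, hF, hFle, hFD, hup⟩ := exists_filter_tendsto_limsup hbdd
  have hD0 : 0 ≤ D := ge_of_tendsto' hFD fun k => norm_nonneg _
  rcases hD0.eq_or_lt with rfl | hD
  · refine tendsto_zero_iff_norm_tendsto_zero.2 (tendsto_order.2 ⟨fun η hη => ?_, fun η hη => ?_⟩)
    · exact Eventually.of_forall fun k => hη.trans_le (norm_nonneg _)
    · simpa using hup η hη
  exfalso
  -- Going back one step along any filter preserves the extremal norm and barely moves `d`.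
  have back : ∀ G : Filter ℕ, G ≤ atTop → Tendsto (fun k => ‖d (k + 1)‖) G (𝓝 D) →
      Tendsto (fun k => ‖d k‖) G (𝓝 D) ∧ Tendsto (fun k => d (k + 1) - d k) G (𝓝 0) := by
    intro G hG hGD
    have hεG := hε.mono_left hG
    have h1 : Tendsto (fun k => ‖d k‖) G (𝓝 D) := by
      refine tendsto_order.2 ⟨fun η hη => ?_, fun η hη => ?_⟩
      · have h2 : Tendsto (fun k => ‖d (k + 1)‖ - ε k) G (𝓝 D) := by simpa using hGD.sub hεG
        filter_upwards [h2.eventually (lt_mem_nhds hη), hG h, hG hlam] with k hk1 hk2 hk3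
        have h3 := norm_add_le (d (k + 1) - lam k • d k) (lam k • d k)
        rw [sub_add_cancel, norm_smul, Real.norm_of_nonneg (ha.le.trans hk3.1)] at h3
        linarith
      · filter_upwards [hG (hup (η - D) (by linarith))] with k hk
        linarith [show ‖d k‖ < D + (η - D) from hk]
    refine ⟨h1, ?_⟩
    have h2 : Tendsto (fun k => a⁻¹ * (|‖d k‖ ^ 2 - ‖d (k + 1)‖ ^ 2| + (2 * M * |ε k| + ε k ^ 2)))
        G (𝓝 0) := by
      have h3 := ((((h1.pow 2).sub (hGD.pow 2)).abs.add
        ((hεG.abs.const_mul (2 * M)).add (hεG.pow 2)))).const_mul a⁻¹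
      simpa using h3
    have h3 : Tendsto (fun k => ‖d (k + 1) - d k‖ ^ 2) G (𝓝 0) := by
      refine squeeze_zero' (Eventually.of_forall fun k => by positivity) ?_ h2
      filter_upwards [hG h, hG hlam] with k hk1 hk2
      have h4 := mul_norm_sub_sq_le_of_norm_sub_smul_le hk1
      have h5 := mul_le_mul_of_nonneg_right hk2.1 (sq_nonneg ‖d (k + 1) - d k‖)
      have h6 : (1 - lam k) * (‖d k‖ ^ 2 - ‖d (k + 1)‖ ^ 2) ≤ |‖d k‖ ^ 2 - ‖d (k + 1)‖ ^ 2| := by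
        refine (mul_le_mul_of_nonneg_left (le_abs_self _) (by linarith)).trans ?_
        exact mul_le_of_le_one_left (abs_nonneg _) (by linarith)
      have h7 : (1 - lam k) * ‖d k‖ * ε k ≤ M * |ε k| := by
        have h8 : (1 - lam k) * ‖d k‖ ≤ M :=
          (mul_le_of_le_one_left (norm_nonneg _) (by linarith)).trans (hM k)
        have h9 : 0 ≤ (1 - lam k) * ‖d k‖ := mul_nonneg (by linarith) (norm_nonneg _)
        exact (mul_le_mul_of_nonneg_left (le_abs_self _) h9).trans
          (mul_le_mul_of_nonneg_right h8 (abs_nonneg _))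
      rw [le_inv_mul_iff₀ ha]
      linarith
    refine tendsto_zero_iff_norm_tendsto_zero.2 ?_
    simpa using h3.sqrt
  have hsub : ∀ j, Tendsto (fun k : ℕ => k - j) F atTop := fun j =>
    (tendsto_sub_atTop_nat j).mono_left hFle
  have hpred : ∀ j, ∀ᶠ k in F, k - (j + 1) + 1 = k - j := fun j => by
    filter_upwards [hFle (eventually_ge_atTop (j + 1))] with k hk
    have : j + 1 ≤ k := hk
    omega
  have shift : ∀ j, Tendsto (fun k => ‖d (k - j)‖) F (𝓝 D) ∧
      Tendsto (fun k => d k - d (k - j)) F (𝓝 0) := by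
    intro j
    induction j with
    | zero => simpa using hFD
    | succ j ih =>
      have h1 := back (map (fun k => k - (j + 1)) F) (hsub (j + 1)) (tendsto_map'_iff.2
        (ih.1.congr' ((hpred j).mono fun k hk => by simp only [Function.comp_apply, hk])))
      refine ⟨tendsto_map'_iff.1 h1.1, ?_⟩
      have h2 : Tendsto (fun k => d (k - j) - d (k - (j + 1))) F (𝓝 0) :=
        (tendsto_map'_iff.1 h1.2).congr'
          ((hpred j).mono fun k hk => by simp only [Function.comp_apply, hk])
      simpa using ih.2.add h2
  -- Each of the last steps of `x` advances by a fixed amount in the direction `d k`.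
  have hbpos : 0 < (1 - b) * D ^ 2 := mul_pos (by linarith) (by positivity)
  have hinner : ∀ j, ∀ᶠ k in F,
      (1 - b) * D ^ 2 / 2 ≤ inner ℝ (x (k - j) - x (k - (j + 1))) (d k) := by
    intro j
    have h1 : Tendsto (fun k => inner ℝ (d (k - (j + 1))) (d k)) F (𝓝 (D ^ 2)) := by
      have h2 : Tendsto (fun k => inner ℝ (d k - d (k - (j + 1))) (d k)) F (𝓝 0) := by
        refine squeeze_zero_norm (a := fun k => ‖d k - d (k - (j + 1))‖ * M) (fun k => ?_) ?_
        · exact (norm_inner_le_norm _ _).trans (by gcongr; exact hM k)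
        · simpa using (shift (j + 1)).2.norm.mul_const M
      have h3 := (hFD.pow 2).sub h2
      rw [sub_zero] at h3
      refine h3.congr fun k => ?_
      rw [inner_sub_left, real_inner_self_eq_norm_sq]
      ring
    have h2 : Tendsto (fun k => inner ℝ (x (k - (j + 1) + 1) - x (k - (j + 1))
        - (1 - lam (k - (j + 1))) • d (k - (j + 1))) (d k)) F (𝓝 0) := by
      refine squeeze_zero_norm (fun k => (norm_inner_le_norm _ _).trans
        (mul_le_mul_of_nonneg_left (hM k) (norm_nonneg _))) ?_
      simpa using (hstep.comp (hsub (j + 1))).norm.mul_const M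
    filter_upwards [hpred j, (hsub (j + 1)).eventually hlam,
      h1.eventually (lt_mem_nhds (show 3 / 4 * D ^ 2 < D ^ 2 by nlinarith)),
      h2.eventually (lt_mem_nhds (show -((1 - b) * D ^ 2 / 4) < 0 by linarith))] with k k1 k2 k3 k4
    rw [k1, inner_sub_left, real_inner_smul_left] at k4
    have h5 : (1 - b) * (3 / 4 * D ^ 2) ≤
        (1 - lam (k - (j + 1))) * inner ℝ (d (k - (j + 1))) (d k) :=
      mul_le_mul (by linarith) k3.le (by positivity) (by linarith)
    linarith
  have hsum : ∀ m : ℕ, ∀ᶠ k in F,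
      m * ((1 - b) * D ^ 2 / 2) ≤ inner ℝ (x k - x (k - m)) (d k) := by
    intro m
    induction m with
    | zero => exact Eventually.of_forall fun k => by simp
    | succ m ih =>
      filter_upwards [ih, hinner m] with k k1 k2
      have h1 : x k - x (k - (m + 1)) = (x k - x (k - m)) + (x (k - m) - x (k - (m + 1))) := by
        abel
      rw [h1, inner_add_left]
      push_cast
      linarith
  obtain ⟨m, hm⟩ := exists_nat_gt ((X + X) * M / ((1 - b) * D ^ 2 / 2))
  obtain ⟨k, hk⟩ := (hsum m).exists
  rw [div_lt_iff₀ (by linarith)] at hm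
  have h1 : inner ℝ (x k - x (k - m)) (d k) ≤ (X + X) * M :=
    (real_inner_le_norm _ _).trans (mul_le_mul
      ((norm_sub_le _ _).trans (add_le_add (hX _) (hX _))) (hM k) (norm_nonneg _)
      (by linarith [(norm_nonneg _).trans (hX 0)]))
  linarith

end Averaged

/-! ### Boundedness of the iterates -/

section Absorbed

/-- Perturbations `p k` that a recursion `a (k + 1) ≤ ξ k * a k + p k` with `0 ≤ ξ k ≤ 1` tolerates:
up to a summable part, they fit into a constant multiple of the deficit `1 - ξ k`. -/
def IsAbsorbed (ξ p : ℕ → ℝ) : Prop :=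
  ∃ (K : ℝ) (s : ℕ → ℝ), (∀ k, 0 ≤ s k) ∧ Summable s ∧ ∀ k, p k ≤ (1 - ξ k) * K + s k

variable {H : Type*} [NormedAddCommGroup H] [InnerProductSpace ℝ H] {ξ p q : ℕ → ℝ}

theorem IsAbsorbed.add (hp : IsAbsorbed ξ p) (hq : IsAbsorbed ξ q) :
    IsAbsorbed ξ fun k => p k + q k := by
  obtain ⟨K, s, hs0, hs, h⟩ := hp
  obtain ⟨L, t, ht0, ht, h'⟩ := hq
  exact ⟨K + L, fun k => s k + t k, fun k => add_nonneg (hs0 k) (ht0 k), hs.add ht,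
    fun k => by linarith [h k, h' k]⟩

theorem IsAbsorbed.mono (hq : IsAbsorbed ξ q) (h : ∀ k, p k ≤ q k) : IsAbsorbed ξ p := by
  obtain ⟨K, s, hs0, hs, h'⟩ := hq
  exact ⟨K, s, hs0, hs, fun k => (h k).trans (h' k)⟩

theorem IsAbsorbed.of_summable (hp : Summable p) (hp0 : ∀ k, 0 ≤ p k) : IsAbsorbed ξ p :=
  ⟨0, p, hp0, hp, fun k => by simp⟩

theorem IsAbsorbed.of_summable_smul_const {a : ℕ → ℝ} (ha : Summable fun k => |a k|) (v : H) :
    IsAbsorbed ξ fun k => ‖a k • v‖ :=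
  .of_summable ((ha.mul_right ‖v‖).congr fun k => by rw [norm_smul, Real.norm_eq_abs])
    fun k => norm_nonneg _

theorem IsAbsorbed.of_add_abs_le_one {a : ℕ → ℝ} (ha : ∀ k, ξ k + |a k| ≤ 1) {v : ℕ → H}
    (hv : BddAbove (Set.range fun k => ‖v k‖)) : IsAbsorbed ξ fun k => ‖a k • v k‖ := by
  obtain ⟨M, hM⟩ := hv
  refine ⟨M, 0, fun k => le_rfl, summable_zero, fun k => ?_⟩
  simp only [norm_smul, Real.norm_eq_abs, Pi.zero_apply, add_zero]
  exact mul_le_mul (by linarith [ha k]) (hM ⟨k, rfl⟩) (norm_nonneg _)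
    (by linarith [ha k, abs_nonneg (a k)])

theorem bddAbove_range_norm_const {E : Type*} [Norm E] (v : E) :
    BddAbove (Set.range fun _ : ℕ => ‖v‖) :=
  ⟨‖v‖, by rintro _ ⟨k, rfl⟩; exact le_rfl⟩

theorem IsAbsorbed.bddAbove_range {a : ℕ → ℝ} (hp : IsAbsorbed ξ p) (hξ0 : ∀ k, 0 ≤ ξ k)
    (hξ1 : ∀ k, ξ k ≤ 1) (h : ∀ k, a (k + 1) ≤ ξ k * a k + p k) : BddAbove (Set.range a) := by
  obtain ⟨K, s, hs0, hs, hK⟩ := hp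
  exact bddAbove_range_of_eventually_le_convex_add_summable hs0 hs
    (Eventually.of_forall fun k => ⟨hξ0 k, hξ1 k, (h k).trans (by gcongr; exact hK k)⟩)

theorem exists_real_eventually_le_of_limsup_lt {a : ℕ → ℝ} {b : ℝ}
    (h : limsup (fun k => ((a k : ℝ) : EReal)) atTop < (b : EReal)) :
    ∃ r < b, ∀ᶠ k in atTop, a k ≤ r := by
  obtain ⟨r, h1, h2⟩ := EReal.lt_iff_exists_real_btwn.1 h
  exact ⟨r, EReal.coe_lt_coe_iff.1 h2,
    (eventually_lt_of_limsup_lt h1).mono fun k hk => (EReal.coe_lt_coe_iff.1 hk).le⟩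

theorem exists_real_eventually_ge_of_lt_liminf {a : ℕ → ℝ} {b : ℝ}
    (h : (b : EReal) < liminf (fun k => ((a k : ℝ) : EReal)) atTop) :
    ∃ r > b, ∀ᶠ k in atTop, r ≤ a k := by
  obtain ⟨r, h1, h2⟩ := EReal.lt_iff_exists_real_btwn.1 h
  exact ⟨r, EReal.coe_lt_coe_iff.1 h1,
    (eventually_lt_of_lt_liminf h2).mono fun k hk => (EReal.coe_lt_coe_iff.1 hk).le⟩

theorem xi_nonneg (b g : ℝ) : 0 ≤ xi b g := add_nonneg (abs_nonneg _) (abs_nonneg _)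

theorem abs_add_le_xi (b g : ℝ) : |b + g| ≤ xi b g := by
  have h := abs_add_le (b + g / 2) (g / 2)
  rwa [add_assoc, add_halves] at h

end Absorbed

section Boundedness

variable {H : Type*} [NormedAddCommGroup H] [InnerProductSpace ℝ H]
  {A : H → Set H} {u : H} {e : ℕ → H} {c α β γ δ : ℕ → ℝ} {x : ℕ → H}

/-- The resolvent values `y k` of an iteration together with the elements `w k` of `A (y k)`
that certify them. -/
theorem IsIteration.exists_resolvent_pairs (hx : IsIteration A u e c α β γ δ x) :
    ∃ y w : ℕ → H, (∀ k, w k ∈ A (y k)) ∧ (∀ k, x k = y k + c k • w k) ∧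
      ∀ k, x (k + 1) = α k • u + β k • x k + γ k • y k + δ k • e k := by
  choose y hy hxy using hx
  choose v hv hxv using hy
  choose w hw hwv using fun k => Set.mem_smul_set.1 (hv k)
  exact ⟨y, w, hw, fun k => by rw [hwv, ← hxv], hxy⟩

/-- The distance to a zero `z` is multiplied by at most `xi (β k) (γ k)`, because
`β x + γ y = (β + γ / 2) x + (γ / 2) (2 y - x)` and the reflection `x ↦ 2 y - x` fixes `z`. -/
theorem IsIteration.norm_sub_zero_le (hA : IsMonotone A) (hc : ∀ k, 0 < c k)
    (hx : IsIteration A u e c α β γ δ x) {z : H} (hz : z ∈ zer A) (k : ℕ) :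
    ‖x (k + 1) - z‖ ≤ xi (β k) (γ k) * ‖x k - z‖ +
      ‖α k • u + δ k • e k - (1 - β k - γ k) • z‖ := by
  obtain ⟨y, w, hw, hxw, hxs⟩ := hx.exists_resolvent_pairs
  have h := hA.norm_reflection_sub_le (hc k).le (hw k) hz
  rw [smul_zero, sub_zero, add_zero, ← hxw k] at h
  have e1 : x (k + 1) - z = (β k + γ k / 2) • (x k - z) + (γ k / 2) • (y k - c k • w k - z)
      + (α k • u + δ k • e k - (1 - β k - γ k) • z) := by
    have e2 : c k • w k = x k - y k := by rw [hxw k]; abel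
    rw [hxs, e2]
    module
  rw [e1]
  refine (norm_add_le _ _).trans (add_le_add_left ((norm_add_le _ _).trans ?_) _)
  rw [norm_smul, norm_smul, Real.norm_eq_abs, Real.norm_eq_abs, xi, add_mul]
  gcongr

/-- In each case the perturbation `α u + δ e - (1 - β - γ) z` is regrouped so that the hypotheses
apply to the single terms: moving `z` into `α • (u - z)` leaves the coefficient `1 - α - β - γ`, and
moving it into `δ • (e - z)` leaves `1 - β - γ - δ`. -/
theorem IsIteration.isBounded_range (hA : IsMonotone A) (hc : ∀ k, 0 < c k)
    (hx : IsIteration A u e c α β γ δ x)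
    (hcond : CondI e α β γ δ ∨ CondII e α β γ δ ∨ CondIII e α β γ δ ∨ CondIV e α β γ δ ∨
      CondV e α β γ δ) (hz : (zer A).Nonempty) : Bornology.IsBounded (Set.range x) := by
  obtain ⟨z, hz⟩ := hz
  have hrec := hx.norm_sub_zero_le hA hc hz
  set ξ : ℕ → ℝ := fun k => xi (β k) (γ k) with hξ
  have hξ0 : ∀ k, 0 ≤ ξ k := fun k => xi_nonneg _ _
  suffices hb : BddAbove (Set.range fun k => ‖x k - z‖) by
    obtain ⟨M, hM⟩ := hb
    refine isBounded_iff_forall_norm_le.2 ⟨M + ‖z‖, ?_⟩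
    rintro _ ⟨k, rfl⟩
    have h1 := norm_add_le (x k - z) z
    rw [sub_add_cancel] at h1
    exact h1.trans (by gcongr; exact hM ⟨k, rfl⟩)
  rcases hcond with h | h | h | h | h
  · obtain ⟨hlim, ⟨a, ha⟩, ⟨b, hb⟩⟩ := h
    obtain ⟨r, hr1, hr⟩ := exists_real_eventually_le_of_limsup_lt (b := 1) (by exact_mod_cast hlim)
    have hr1' : (1 - r) ≠ 0 := by linarith
    refine bddAbove_range_of_eventually_le_convex_add_summable (ξ := fun _ => r) (s := 0)
      (K := (a * ‖u‖ + b + 2 * ‖z‖) / (1 - r)) (fun k => le_rfl) summable_zero ?_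
    filter_upwards [hr] with k hk
    refine ⟨(hξ0 k).trans hk, hr1.le, (hrec k).trans ?_⟩
    rw [mul_div_cancel₀ _ hr1', Pi.zero_apply, add_zero]
    refine add_le_add (mul_le_mul_of_nonneg_right hk (norm_nonneg _)) ?_
    refine (norm_sub_le _ _).trans (add_le_add ((norm_add_le _ _).trans (add_le_add ?_ ?_)) ?_)
    · rw [norm_smul, Real.norm_eq_abs]
      gcongr
      exact ha ⟨k, rfl⟩
    · exact hb ⟨k, rfl⟩
    · rw [norm_smul, Real.norm_eq_abs]
      gcongr
      have h1 : |1 - β k - γ k| ≤ |1| + |β k + γ k| := by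
        rw [sub_sub]; exact abs_sub _ _
      have h2 : |β k + γ k| ≤ ξ k := abs_add_le_xi _ _
      rw [abs_one] at h1
      linarith
  · obtain ⟨h1, h2, h3, h4⟩ := h
    refine IsAbsorbed.bddAbove_range ?_ hξ0 h1 hrec
    have p2 : IsAbsorbed ξ fun k => ‖α k • u‖ := h2.elim
      (fun h2 => .of_add_abs_le_one (fun k => by rw [add_comm]; exact h2 k)
        (bddAbove_range_norm_const u))
      fun h2 => .of_summable_smul_const h2 u
    have p3 : IsAbsorbed ξ fun k => ‖δ k • e k‖ := h3.elim
      (fun h3 => .of_add_abs_le_one h3.1 h3.2) fun h3 => .of_summable h3 fun k => norm_nonneg _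
    have p4 : IsAbsorbed ξ fun k => ‖(1 - β k - γ k) • z‖ := h4.elim
      (fun h4 => .of_add_abs_le_one h4 (bddAbove_range_norm_const z))
      fun h4 => .of_summable_smul_const h4 z
    exact ((p2.add p3).add p4).mono fun k =>
      (norm_sub_le _ _).trans (by gcongr; exact norm_add_le _ _)
  · obtain ⟨h1, h2, h3⟩ := h
    refine IsAbsorbed.bddAbove_range ?_ hξ0
      (fun k => by linarith [h1 k, abs_nonneg (α k)]) hrec
    have p1 : IsAbsorbed ξ fun k => ‖α k • (u - z)‖ :=
      .of_add_abs_le_one (fun k => by rw [add_comm]; exact h1 k) (bddAbove_range_norm_const _)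
    have p2 : IsAbsorbed ξ fun k => ‖(1 - α k - β k - γ k) • z‖ := .of_summable_smul_const h2 z
    have p3 : IsAbsorbed ξ fun k => ‖δ k • e k‖ := .of_summable h3 fun k => norm_nonneg _
    refine ((p1.add p3).add p2).mono fun k => ?_
    rw [show α k • u + δ k • e k - (1 - β k - γ k) • z =
      α k • (u - z) + δ k • e k - (1 - α k - β k - γ k) • z by module]
    exact (norm_sub_le _ _).trans (by gcongr; exact norm_add_le _ _)
  · obtain ⟨⟨M, hM⟩, h2, h3, h4⟩ := h
    refine IsAbsorbed.bddAbove_range ?_ hξ0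
      (fun k => by linarith [h4 k, abs_nonneg (δ k)]) hrec
    have p1 : IsAbsorbed ξ fun k => ‖δ k • (e k - z)‖ := by
      refine .of_add_abs_le_one h4 ⟨M + ‖z‖, ?_⟩
      rintro _ ⟨k, rfl⟩
      exact (norm_sub_le _ _).trans (by gcongr; exact hM ⟨k, rfl⟩)
    have p2 : IsAbsorbed ξ fun k => ‖α k • u‖ := .of_summable_smul_const h2 u
    have p3 : IsAbsorbed ξ fun k => ‖(1 - β k - γ k - δ k) • z‖ := .of_summable_smul_const h3 z
    refine ((p2.add p1).add p3).mono fun k => ?_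
    rw [show α k • u + δ k • e k - (1 - β k - γ k) • z =
      α k • u + δ k • (e k - z) - (1 - β k - γ k - δ k) • z by module]
    exact (norm_sub_le _ _).trans (by gcongr; exact norm_add_le _ _)
  · obtain ⟨h1, h2, h3⟩ := h
    refine IsAbsorbed.bddAbove_range ?_ hξ0 (fun k => by linarith [(h1 k).2.2, (h1 k).1]) hrec
    -- The whole perturbation is `α k` times a bounded sequence.
    have hv : Tendsto (fun k => ‖(u - z) + (α k)⁻¹ • (δ k • e k)
        - ((1 - α k - β k - γ k) / α k) • z‖) atTop (𝓝 ‖(u - z) + 0 - (0 : ℝ) • z‖) :=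
      ((tendsto_const_nhds.add h2).sub (h3.smul_const z)).norm
    refine (IsAbsorbed.of_add_abs_le_one (a := α) (fun k => ?_) hv.bddAbove_range).mono
      fun k => le_of_eq ?_
    · rw [abs_of_pos (h1 k).1, add_comm]
      exact (h1 k).2.2
    · have h0 : α k ≠ 0 := (h1 k).1.ne'
      rw [smul_sub, smul_add, smul_inv_smul₀ h0, smul_smul, mul_div_cancel₀ _ h0]
      congr 1
      module

end Boundedness

/-! ### Zeros from bounded iterates -/

section Zeros

variable {H : Type*} [NormedAddCommGroup H] [InnerProductSpace ℝ H]

theorem tendsto_smul_zero_of_isBounded {a : ℕ → ℝ} {v : ℕ → H} (ha : Tendsto a atTop (𝓝 0))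
    (hv : Bornology.IsBounded (Set.range v)) : Tendsto (fun k => a k • v k) atTop (𝓝 0) := by
  obtain ⟨M, hM⟩ := hv.exists_norm_le
  refine squeeze_zero_norm (a := fun k => |a k| * M) (fun k => ?_) ?_
  · rw [norm_smul, Real.norm_eq_abs]
    gcongr
    exact hM _ ⟨k, rfl⟩
  · simpa using ha.abs.mul_const M

theorem isBounded_range_smul {a : ℕ → ℝ} {v : ℕ → H}
    (ha : IsBoundedUnder (· ≤ ·) atTop fun k => |a k|) (hv : Bornology.IsBounded (Set.range v)) :
    Bornology.IsBounded (Set.range fun k => a k • v k) := by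
  obtain ⟨M, hM⟩ := hv.exists_norm_le
  obtain ⟨B, hB⟩ := ha.bddAbove_range
  refine isBounded_iff_forall_norm_le.2 ⟨B * M, ?_⟩
  rintro _ ⟨k, rfl⟩
  have h1 : |a k| ≤ B := hB ⟨k, rfl⟩
  rw [norm_smul, Real.norm_eq_abs]
  exact mul_le_mul h1 (hM _ ⟨k, rfl⟩) (norm_nonneg _) ((abs_nonneg _).trans h1)

theorem isBounded_range_add {E : Type*} [SeminormedAddCommGroup E] {v w : ℕ → E}
    (hv : Bornology.IsBounded (Set.range v))
    (hw : Bornology.IsBounded (Set.range w)) :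
    Bornology.IsBounded (Set.range fun k => v k + w k) := by
  refine (hv.add hw).subset ?_
  rintro _ ⟨k, rfl⟩
  exact Set.add_mem_add ⟨k, rfl⟩ ⟨k, rfl⟩

theorem isBounded_range_sub {E : Type*} [SeminormedAddCommGroup E] {v w : ℕ → E}
    (hv : Bornology.IsBounded (Set.range v))
    (hw : Bornology.IsBounded (Set.range w)) :
    Bornology.IsBounded (Set.range fun k => v k - w k) := by
  refine (hv.sub hw).subset ?_
  rintro _ ⟨k, rfl⟩
  exact Set.sub_mem_sub ⟨k, rfl⟩ ⟨k, rfl⟩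

variable {A : H → Set H} {u : H} {e : ℕ → H} {c α β γ δ : ℕ → ℝ} {x y w : ℕ → H}

/-- Solving the iteration for `γ k • y k` bounds the resolvent values, as `γ` stays away from
zero. -/
theorem isBounded_range_resolvent
    (hxs : ∀ k, x (k + 1) = α k • u + β k • x k + γ k • y k + δ k • e k)
    (hx : Bornology.IsBounded (Set.range x)) (hα : Tendsto α atTop (𝓝 0))
    (hβ : IsBoundedUnder (· ≤ ·) atTop fun k => |β k|)
    (hδ : Tendsto (fun k => δ k • e k) atTop (𝓝 0)) {g : ℝ} (hg : 0 < g)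
    (hγ : ∀ᶠ k in atTop, g ≤ |γ k|) : Bornology.IsBounded (Set.range y) := by
  have hx' : Bornology.IsBounded (Set.range fun k => x (k + 1)) :=
    hx.subset (by rintro _ ⟨k, rfl⟩; exact ⟨k + 1, rfl⟩)
  have h1 : Bornology.IsBounded (Set.range fun k => γ k • y k) := by
    have h2 := isBounded_range_sub (isBounded_range_sub (isBounded_range_sub hx'
      (Metric.isBounded_range_of_tendsto _ (hα.smul_const u))) (isBounded_range_smul hβ hx))
      (Metric.isBounded_range_of_tendsto _ hδ)
    convert h2 using 3 with k
    rw [hxs]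
    abel
  have h3 : IsBoundedUnder (· ≤ ·) atTop fun k => |(γ k)⁻¹| := by
    refine ⟨g⁻¹, eventually_map.2 (hγ.mono fun k hk => ?_)⟩
    rw [abs_inv]
    exact inv_anti₀ hg hk
  have h4 := isBounded_range_smul h3 h1
  -- Where `γ k = 0` the inverse is a junk value, but this happens for finitely many `k` only.
  obtain ⟨M, hM⟩ := h4.exists_norm_le
  have h5 : IsBoundedUnder (· ≤ ·) atTop fun k => ‖y k‖ := by
    refine ⟨M, eventually_map.2 (hγ.mono fun k hk => ?_)⟩
    have h6 : γ k ≠ 0 := abs_pos.1 (hg.trans_le hk)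
    have h7 := hM _ ⟨k, rfl⟩
    simpa only [inv_smul_smul₀ h6] using h7
  obtain ⟨B, hB⟩ := h5.bddAbove_range
  exact isBounded_iff_forall_norm_le.2 ⟨B, by rintro _ ⟨k, rfl⟩; exact hB ⟨k, rfl⟩⟩

theorem tendsto_succ_sub_resolvent
    (hxs : ∀ k, x (k + 1) = α k • u + β k • x k + γ k • y k + δ k • e k)
    (hx : Bornology.IsBounded (Set.range x)) (hy : Bornology.IsBounded (Set.range y))
    (hα : Tendsto α atTop (𝓝 0)) (hβ : Tendsto β atTop (𝓝 0)) (hγ : Tendsto γ atTop (𝓝 1))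
    (hδ : Tendsto (fun k => δ k • e k) atTop (𝓝 0)) :
    Tendsto (fun k => x (k + 1) - y k) atTop (𝓝 0) := by
  have hγ' : Tendsto (fun k => γ k - 1) atTop (𝓝 0) := by simpa using hγ.sub_const 1
  have h := (((hα.smul_const u).add (tendsto_smul_zero_of_isBounded hβ hx)).add
    (tendsto_smul_zero_of_isBounded hγ' hy)).add hδ
  simp only [zero_smul, add_zero] at h
  refine h.congr fun k => ?_
  rw [hxs]
  module

theorem eventually_half_le_abs (hγ : Tendsto γ atTop (𝓝 1)) : ∀ᶠ k in atTop, 1 / 2 ≤ |γ k| := by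
  filter_upwards [hγ.eventually (lt_mem_nhds (show (1 / 2 : ℝ) < 1 by norm_num))] with k hk
  exact hk.le.trans (le_abs_self _)

variable [CompleteSpace H]

/-- If `x - y` tends to zero and the parameters stay away from zero, then
`w = c⁻¹ • (x - y) ∈ A y` tends to zero too. -/
theorem IsMaximallyMonotone.zer_nonempty_of_tendsto_sub (hA : IsMaximallyMonotone A)
    (hw : ∀ k, w k ∈ A (y k)) (hxw : ∀ k, x k = y k + c k • w k)
    (hy : Bornology.IsBounded (Set.range y)) {m : ℝ} (hm : 0 < m) (hc : ∀ᶠ k in atTop, m ≤ c k)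
    (h : Tendsto (fun k => x k - y k) atTop (𝓝 0)) : (zer A).Nonempty := by
  refine hA.zer_nonempty_of_tendsto hw hy
    (squeeze_zero_norm' (a := fun k => m⁻¹ * ‖x k - y k‖) ?_ ?_)
  · filter_upwards [hc] with k hk
    rw [hxw k, add_sub_cancel_left, norm_smul, Real.norm_of_nonneg (hm.le.trans hk),
      le_inv_mul_iff₀ hm]
    gcongr
  · simpa using h.norm.const_mul m⁻¹

/-- The values `w = c⁻¹ • (x - y) ∈ A y` tend to zero because `c` tends to infinity. -/
theorem CondA.zer_nonempty (hA : IsMaximallyMonotone A)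
    (hx : IsIteration A u e c α β γ δ x) (h : CondA e c α β γ δ)
    (hb : Bornology.IsBounded (Set.range x)) : (zer A).Nonempty := by
  obtain ⟨hc', hα, hβ, hγ, hδ⟩ := h
  obtain ⟨y, w, hw, hxw, hxs⟩ := hx.exists_resolvent_pairs
  have hy := isBounded_range_resolvent hxs hb hα hβ.abs.isBoundedUnder_le hδ one_half_pos
    (eventually_half_le_abs hγ)
  refine hA.zer_nonempty_of_tendsto hw hy ?_
  refine (tendsto_smul_zero_of_isBounded (tendsto_inv_atTop_zero.comp hc')
    (isBounded_range_sub hb hy)).congr' ?_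
  filter_upwards [hc'.eventually_gt_atTop 0] with k hk
  rw [hxw k, add_sub_cancel_left]
  exact inv_smul_smul₀ hk.ne' _

/-- Up to errors tending to zero, `x (k + 1)` is an average of `x k` and the reflected resolvent
`y k - c k • w k` with weights away from `0` and `1`, so that `tendsto_zero_of_averaged_steps`
applies to `d k = 2 • (y k - x k)`, the displacement of the reflection. -/
theorem CondB.zer_nonempty (hA : IsMaximallyMonotone A) (hc : ∀ k, 0 < c k)
    (hx : IsIteration A u e c α β γ δ x) (h : CondB e c α β γ δ)
    (hb : Bornology.IsBounded (Set.range x)) : (zer A).Nonempty := by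
  obtain ⟨-, hα, hβ, hαβγ, hinf, hsup, hδ, hcc, hcm⟩ := h
  obtain ⟨y, w, hw, hxw, hxs⟩ := hx.exists_resolvent_pairs
  obtain ⟨b, -, hb1⟩ := exists_real_eventually_le_of_limsup_lt (b := 1) (by exact_mod_cast hβ)
  obtain ⟨μ, hμ0, hμ⟩ := exists_real_eventually_ge_of_lt_liminf (b := 0) (by exact_mod_cast hinf)
  obtain ⟨ν, hν1, hν⟩ := exists_real_eventually_le_of_limsup_lt (b := 1) (by exact_mod_cast hsup)
  have hβγ : Tendsto (fun k => 1 - β k - γ k) atTop (𝓝 0) := by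
    simpa using (hαβγ.add hα).congr fun k => show _ = 1 - β k - γ k by ring
  -- `γ / 2` differs from `1 - β - γ / 2` by `1 - β - γ`, hence stays away from `0`.
  have hγ : ∀ᶠ k in atTop, μ ≤ |γ k| := by
    filter_upwards [hμ, hβγ.eventually (gt_mem_nhds (half_pos hμ0))] with k h1 h2
    exact le_trans (by linarith) (le_abs_self _)
  have hy := isBounded_range_resolvent hxs hb hα ⟨b, eventually_map.2 hb1⟩ hδ hμ0 hγ
  have hcw : ∀ k, c k • w k = x k - y k := fun k => by rw [hxw k]; abel
  have hd : Bornology.IsBounded (Set.range fun k => (2 : ℝ) • (y k - x k)) :=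
    isBounded_range_smul (a := fun _ => 2) isBoundedUnder_const (isBounded_range_sub hy hb)
  have hstep : Tendsto (fun k => x (k + 1) - x k - (1 - (β k + γ k / 2)) • (2 : ℝ) • (y k - x k))
      atTop (𝓝 0) := by
    have h1 := ((hα.smul_const u).add hδ).add (tendsto_smul_zero_of_isBounded hβγ
      (isBounded_range_sub hb (isBounded_range_add hy hy)))
    simp only [zero_smul, add_zero] at h1
    refine h1.congr fun k => ?_
    rw [hxs]
    module
  have hcdiff : Tendsto (fun k => (c (k + 1) - c k) • w k) atTop (𝓝 0) := by
    have h1 : Tendsto (fun k => c (k + 1) / c k - 1) atTop (𝓝 0) := by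
      have h2 : Tendsto (fun k => c k / c (k + 1)) atTop (𝓝 1) := by
        simpa using hcc.const_sub 1
      have h3 := (h2.inv₀ one_ne_zero).sub_const 1
      simpa only [inv_div, inv_one, sub_self] using h3
    refine (tendsto_smul_zero_of_isBounded h1 (isBounded_range_sub hb hy)).congr fun k => ?_
    rw [← hcw, smul_smul, sub_mul, div_mul_cancel₀ _ (hc k).ne', one_mul]
  have hlim := tendsto_zero_of_averaged_steps (x := x) (lam := fun k => β k + γ k / 2)
    (d := fun k => (2 : ℝ) • (y k - x k)) (a := 1 - ν) (b := 1 - μ)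
    (ε := fun k => 2 * ‖x (k + 1) - x k - (1 - (β k + γ k / 2)) • (2 : ℝ) • (y k - x k)‖
      + 2 * ‖(c (k + 1) - c k) • w k‖)
    (by linarith) (by linarith)
    (by filter_upwards [hμ, hν] with k h1 h2; constructor <;> linarith) hb hd hstep
    (by simpa using (hstep.norm.const_mul 2).add (hcdiff.norm.const_mul 2)) (by
      filter_upwards [hμ] with k hk
      have h1 := hA.1.norm_reflection_sub_le_add (c := c k) (hc (k + 1)).le (hw k) (hw (k + 1))
      rw [← hxw, ← hxw, hcw, hcw] at h1
      set r := x (k + 1) - x k - (1 - (β k + γ k / 2)) • (2 : ℝ) • (y k - x k) with hr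
      have e1 : x (k + 1) - x k = r + (1 - (β k + γ k / 2)) • (2 : ℝ) • (y k - x k) := by
        rw [hr]; abel
      have h2 : ‖x (k + 1) - x k‖ ≤
          ‖r‖ + (1 - (β k + γ k / 2)) * ‖(2 : ℝ) • (y k - x k)‖ := by
        rw [e1]
        refine (norm_add_le _ _).trans (le_of_eq ?_)
        rw [norm_smul (1 - (β k + γ k / 2)), Real.norm_of_nonneg (by linarith)]
      have e2 : (2 : ℝ) • (y (k + 1) - x (k + 1)) - (β k + γ k / 2) • (2 : ℝ) • (y k - x k) =
          (y (k + 1) - (x (k + 1) - y (k + 1)) - (y k - (x k - y k))) - r := by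
        rw [hr]; module
      rw [e2]
      linarith [norm_sub_le (y (k + 1) - (x (k + 1) - y (k + 1)) - (y k - (x k - y k))) r])
  have hxy : Tendsto (fun k => x k - y k) atTop (𝓝 0) := by
    have h1 := hlim.const_smul (-(1 / 2) : ℝ)
    rw [smul_zero] at h1
    exact h1.congr fun k => by module
  rcases hcm with hm | hinfty
  · exact hA.zer_nonempty_of_tendsto_sub hw hxw hy hm (Eventually.of_forall fun k =>
      ciInf_le ⟨0, by rintro _ ⟨k, rfl⟩; exact (hc k).le⟩ k) hxy
  · exact hA.zer_nonempty_of_tendsto_sub hw hxw hy one_pos (hinfty.eventually_ge_atTop 1) hxy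

/-- Consecutive iterates approach each other by the lemma of Xu with factors `|γ (k + 1)|`. -/
theorem CondC.zer_nonempty (hA : IsMaximallyMonotone A) (hc : ∀ k, 0 < c k)
    (hx : IsIteration A u e c α β γ δ x) (h : CondC e c α β γ δ)
    (hb : Bornology.IsBounded (Set.range x)) : (zer A).Nonempty := by
  obtain ⟨hΔα, hγ1, hα, hαγ, hΔαγ, hβs, hdiv, hδs, hm, hΔc⟩ := h
  obtain ⟨y, w, hw, hxw, hxs⟩ := hx.exists_resolvent_pairs
  have hβ : Tendsto β atTop (𝓝 0) := (tendsto_zero_iff_abs_tendsto_zero _).2 hβs.tendsto_atTop_zero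
  have hδ : Tendsto (fun k => δ k • e k) atTop (𝓝 0) :=
    tendsto_zero_iff_norm_tendsto_zero.2 hδs.tendsto_atTop_zero
  have hγ : Tendsto γ atTop (𝓝 1) := by simpa using hαγ.sub hα
  have hy := isBounded_range_resolvent hxs hb hα hβ.abs.isBoundedUnder_le hδ one_half_pos
    (eventually_half_le_abs hγ)
  set m := ⨅ k, c k with hm_def
  have hcm : ∀ k, m ≤ c k := fun k => ciInf_le ⟨0, by rintro _ ⟨k, rfl⟩; exact (hc k).le⟩ k
  obtain ⟨X, hX⟩ := hb.exists_norm_le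
  obtain ⟨Y, hY⟩ := hy.exists_norm_le
  replace hX : ∀ k, ‖x k‖ ≤ X := fun k => hX _ ⟨k, rfl⟩
  replace hY : ∀ k, ‖y k‖ ≤ Y := fun k => hY _ ⟨k, rfl⟩
  have hX0 : 0 ≤ X := (norm_nonneg _).trans (hX 0)
  have hY0 : 0 ≤ Y := (norm_nonneg _).trans (hY 0)
  have hW : ∀ k, ‖w k‖ ≤ (X + Y) / m := fun k => by
    rw [le_div_iff₀ hm]
    have h1 : ‖c k • w k‖ ≤ X + Y := by
      rw [show c k • w k = x k - y k by rw [hxw k]; abel]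
      exact (norm_sub_le _ _).trans (add_le_add (hX k) (hY k))
    rw [norm_smul, Real.norm_of_nonneg (hc k).le] at h1
    linarith [mul_le_mul_of_nonneg_right (hcm k) (norm_nonneg (w k))]
  -- Both alternatives for the increments of `α` have the form that the lemma of Xu admits.
  obtain ⟨τ, σ, hτ, hσ0, hσ, hτσ⟩ : ∃ τ σ : ℕ → ℝ, Tendsto τ atTop (𝓝 0) ∧ (∀ k, 0 ≤ σ k) ∧
      Summable σ ∧ ∀ k, |α (k + 1) - α k| ≤ (1 - |γ (k + 1)|) * τ k + σ k := by
    rcases hΔα with h | ⟨h1, h2⟩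
    · exact ⟨0, _, tendsto_const_nhds, fun k => abs_nonneg _, h, fun k => by simp⟩
    · refine ⟨_, 0, h2, fun k => le_rfl, summable_zero, fun k => le_of_eq ?_⟩
      rw [mul_div_cancel₀ _ (sub_ne_zero.2 (h1 (k + 1)).symm), Pi.zero_apply, add_zero]
  have hdiv' : SumDiverges fun k => 1 - |γ (k + 1)| := by
    refine (tendsto_atTop_add_const_right _ (-(1 - |γ 0|))
      (hdiv.comp (tendsto_add_atTop_nat 1))).congr fun n => ?_
    simp only [Function.comp_apply]
    rw [Finset.sum_range_succ']
    ring
  have hXu := tendsto_zero_of_le_convex_add_summable (a := fun k => ‖x (k + 1) - x k‖)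
    (t := fun k => 1 - |γ (k + 1)|) (τ := fun k => τ k * (‖u‖ + Y))
    (s := fun k => σ k * (‖u‖ + Y) + |c (k + 1) - c k| * ((X + Y) / m)
      + |(α (k + 1) + γ (k + 1)) - (α k + γ k)| * Y + (|β (k + 1)| + |β k|) * X
      + (‖δ (k + 1) • e (k + 1)‖ + ‖δ k • e k‖))
    (fun k => norm_nonneg _) (fun k => sub_nonneg.2 (hγ1 _))
    (fun k => sub_le_self _ (abs_nonneg _)) hdiv' (by simpa using hτ.mul_const (‖u‖ + Y))
    (fun k => by have := hσ0 k; positivity)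
    (((((hσ.mul_right _).add (hΔc.mul_right _)).add (hΔαγ.mul_right _)).add
      ((((summable_nat_add_iff 1).2 hβs).add hβs).mul_right _)).add
      (((summable_nat_add_iff 1).2 hδs).add hδs)) (fun k => by
      have h1 := hA.1.norm_resolvent_sub_le_add (c := c k) (hc (k + 1)).le (hw k) (hw (k + 1))
      rw [← hxw, ← hxw] at h1
      have e1 : x (k + 1 + 1) - x (k + 1) = γ (k + 1) • (y (k + 1) - y k)
          + (α (k + 1) - α k) • (u - y k)
          + ((α (k + 1) + γ (k + 1)) - (α k + γ k)) • y k
          + (β (k + 1) • x (k + 1) - β k • x k)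
          + (δ (k + 1) • e (k + 1) - δ k • e k) := by
        rw [hxs (k + 1), hxs k]
        module
      have b1 : ‖γ (k + 1) • (y (k + 1) - y k)‖ ≤
          |γ (k + 1)| * ‖x (k + 1) - x k‖ + |c (k + 1) - c k| * ((X + Y) / m) := by
        rw [norm_smul, Real.norm_eq_abs]
        rw [norm_smul (c (k + 1) - c k), Real.norm_eq_abs] at h1
        have h2 := mul_le_mul_of_nonneg_left h1 (abs_nonneg (γ (k + 1)))
        have h3 := mul_le_mul_of_nonneg_left (hW k) (abs_nonneg (c (k + 1) - c k))
        have h4 := mul_le_of_le_one_left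
          (mul_nonneg (abs_nonneg (c (k + 1) - c k)) (norm_nonneg (w k))) (hγ1 (k + 1))
        linarith
      have b2 : ‖(α (k + 1) - α k) • (u - y k)‖ ≤
          ((1 - |γ (k + 1)|) * τ k + σ k) * (‖u‖ + Y) := by
        rw [norm_smul, Real.norm_eq_abs]
        exact mul_le_mul (hτσ k) ((norm_sub_le _ _).trans (by gcongr; exact hY k))
          (norm_nonneg _) ((abs_nonneg _).trans (hτσ k))
      have b3 : ‖((α (k + 1) + γ (k + 1)) - (α k + γ k)) • y k‖ ≤
          |(α (k + 1) + γ (k + 1)) - (α k + γ k)| * Y := by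
        rw [norm_smul, Real.norm_eq_abs]
        gcongr
        exact hY k
      have b4 : ‖β (k + 1) • x (k + 1) - β k • x k‖ ≤ (|β (k + 1)| + |β k|) * X := by
        refine (norm_sub_le _ _).trans ?_
        rw [norm_smul, norm_smul, Real.norm_eq_abs, Real.norm_eq_abs, add_mul]
        gcongr
        · exact hX _
        · exact hX _
      have b5 := norm_sub_le (δ (k + 1) • e (k + 1)) (δ k • e k)
      have htri := norm_add_le_of_le (norm_add_le_of_le (norm_add_le_of_le
        (norm_add_le_of_le b1 b2) b3) b4) b5
      rw [← e1] at htri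
      linarith)
  have hstep : Tendsto (fun k => x (k + 1) - x k) atTop (𝓝 0) :=
    tendsto_zero_iff_norm_tendsto_zero.2 hXu
  refine hA.zer_nonempty_of_tendsto_sub hw hxw hy hm (Eventually.of_forall hcm) ?_
  simpa using (tendsto_succ_sub_resolvent hxs hb hy hα hβ hγ hδ).sub hstep

end Zeros

end GenPPA

theorem theorem3p14 {H : Type*} [NormedAddCommGroup H] [InnerProductSpace ℝ H] [CompleteSpace H]
    (A : H → Set H) (hA : GenPPA.IsMaximallyMonotone A)
    (u : H) (e : ℕ → H) (c α β γ δ : ℕ → ℝ) (hc : ∀ k, 0 < c k)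
    (x : ℕ → H) (hx : GenPPA.IsIteration A u e c α β γ δ x)
    (hcond : GenPPA.CondI e α β γ δ ∨ GenPPA.CondII e α β γ δ ∨ GenPPA.CondIII e α β γ δ ∨
      GenPPA.CondIV e α β γ δ ∨ GenPPA.CondV e α β γ δ) :
    ((GenPPA.zer A).Nonempty → Bornology.IsBounded (Set.range x)) ∧
    ((GenPPA.CondA e c α β γ δ ∨ GenPPA.CondB e c α β γ δ ∨ GenPPA.CondC e c α β γ δ) →
      ((GenPPA.zer A).Nonempty ↔ Bornology.IsBounded (Set.range x))) := by
  have hbdd := hx.isBounded_range hA.1 hc hcond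
  refine ⟨hbdd, fun h => ⟨hbdd, fun hb => ?_⟩⟩
  rcases h with h | h | h
  · exact h.zer_nonempty hA hx hb
  · exact h.zer_nonempty hA hc hx hb
  · exact h.zer_nonempty hA hc hx hb
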